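/- An integer matrix is called $\Delta$-modular if every $\operatorname{rank}(\mathbf A)\times\operatorname{rank}(\mathbf A)$ submatrix of $\mathbf A$ has determinant at most $\Delta$ in absolute value. For $m\ge 1$ let $\mathbf D_m$ be the matrix with $m$ rows whose columns are $\mathbf e_i-\mathbf e_j$ for all $1\le i<j\le m$. Let $r\ge 1$ be an integer and let $\mathbf a,\mathbf b\in\mathbb Z^{r-1}$ with $\mathbf a\ne\mathbf b$. Suppose that the matrix with $r+1$ rows $$\mathbf A=\left[\;\mathbf D_{r+1}\;\middle|\;\begin{matrix}\mathbf a&\mathbf b\\ 1&0\\ 0&1\end{matrix}\;\right]$$ is $3$-modular, that its rows sum to $\mathbf 0$, and that no two of its columns are parallel (non-zero scalar multiples of each other). Then the matrix $[\mathbf a\;\mathbf b]$, after deleting all its all-zero rows and up to permuting its rows and its columns, is one of the following eight matrices: $$\begin{bmatrix}-3&-2\\2&1\end{bmatrix},\quad \begin{bmatrix}-2&1\\1&-2\end{bmatrix},\quad \begin{bmatrix}-2&1\\1&-1\\0&-1\end{bmatrix},\quad \begin{bmatrix}-2&-1\\1&1\\0&-1\end{bmatrix},$$ $$\begin{bmatrix}-2&-1\\2&1\\-1&-1\end{bmatrix},\quad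 \begin{bmatrix}-1&-1\\-1&1\\1&-1\end{bmatrix},\quad \begin{bmatrix}-1&-1\\1&1\\-1&0\\0&-1\end{bmatrix},\quad \begin{bmatrix}-1&1\\1&-1\\-1&0\\0&-1\end{bmatrix}.$$ -/

import Mathlib

/-- An integer matrix `A` is `Δ`-modular if every `rank A × rank A` submatrix has determinant at
most `Δ` in absolute value. -/
def IsModular {m n : Type*} [Fintype n] (Δ : ℕ) (A : Matrix m n ℤ) : Prop :=
  ∀ (f : Fin (A.map (Int.cast : ℤ → ℝ)).rank ↪ m) (g : Fin (A.map (Int.cast : ℤ → ℝ)).rank ↪ n),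
    |(A.submatrix f g).det| ≤ (Δ : ℤ)

/-- Two integer vectors are parallel if each is a non-zero real multiple of the other. -/
def AreParallel {m : Type*} (u v : m → ℤ) : Prop :=
  ∃ c : ℝ, c ≠ 0 ∧ ∀ i, (u i : ℝ) = c * (v i : ℝ)

/-- No two (differently indexed) columns of `A` are parallel. -/
def NoParallelColumns {m n : Type*} (A : Matrix m n ℤ) : Prop :=
  ∀ j k : n, j ≠ k → ¬ AreParallel (fun i => A i j) (fun i => A i k)

/-- The rows of `A` sum to the zero vector. -/
def RowsSumToZero {m n : Type*} [Fintype m] (A : Matrix m n ℤ) : Prop :=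
  ∀ j : n, ∑ i, A i j = 0

/-- The matrix `D_m` with `m` rows, whose columns are `e_i - e_j` for all `i < j`. -/
def cliqueMatrix (m : ℕ) : Matrix (Fin m) {p : Fin m × Fin m // p.1 < p.2} ℤ :=
  Matrix.of fun i p => (Pi.single p.1.1 1 - Pi.single p.1.2 1 : Fin m → ℤ) i

/-- The matrix with the two columns `a` and `b`. -/
def twoColumns {m : ℕ} (a b : Fin m → ℤ) : Matrix (Fin m) (Fin 2) ℤ :=
  Matrix.of fun i => ![a i, b i]

/-- The matrix `[D_{n+2} | (a, 1, 0) | (b, 0, 1)]` with `n + 2` rows. -/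
def cliqueExtension {n : ℕ} (a b : Fin n → ℤ) :
    Matrix (Fin (n + 2)) ({p : Fin (n + 2) × Fin (n + 2) // p.1 < p.2} ⊕ Fin 2) ℤ :=
  Matrix.fromCols (cliqueMatrix (n + 2))
    (twoColumns (Fin.append a ![1, 0]) (Fin.append b ![0, 1]))

/-- After deleting its all-zero rows, `A` is equal to `M` up to a permutation of the rows and a
permutation of the columns. -/
def ReducesTo {m k l : ℕ} (A : Matrix (Fin m) (Fin l) ℤ) (M : Matrix (Fin k) (Fin l) ℤ) : Prop :=
  ∃ (e : {i : Fin m // ∃ j, A i j ≠ 0} ≃ Fin k) (σ : Equiv.Perm (Fin l)),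
    ∀ i j, A i.1 j = M (e i) (σ j)

/-- The eight two-column matrices (the first component is the number of rows). -/
def eightMatrices : List (Σ k : ℕ, Matrix (Fin k) (Fin 2) ℤ) :=
  [⟨2, !![-3, -2;
           2,  1]⟩,
   ⟨2, !![-2,  1;
           1, -2]⟩,
   ⟨3, !![-2,  1;
           1, -1;
           0, -1]⟩,
   ⟨3, !![-2, -1;
           1,  1;
           0, -1]⟩,
   ⟨3, !![-2, -1;
           2,  1;
          -1, -1]⟩,
   ⟨3, !![-1, -1;
          -1,  1;
           1, -1]⟩,
   ⟨4, !![-1, -1;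
           1,  1;
          -1,  0;
           0, -1]⟩,
   ⟨4, !![-1,  1;
           1, -1;
          -1,  0;
           0, -1]⟩]

/-! The hypotheses reduce to a finite problem on the rows `(a i, b i)` together with `(1, 0)` and
`(0, 1)`. The rank is one less than the number of rows. Deleting a row `r` and using columns of the
clique matrix to contract a row set `S` to one row and a disjoint set `T` to another, the rest going
to `r`, leaves up to sign the 2 × 2 determinant of the two row sums. So 3-modularity bounds these
determinants for all disjoint `S`, `T` (`natAbs_det₂_sum_le`).

Pairing with the unit rows puts the coordinates of every subset sum of the rows `(a i, b i)` in
`[-3, 2]`. This leaves 35 possible nonzero rows, each of bounded multiplicity, and an exhaustive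
kernel-checked search (`search_candidateRows`) lists the multisets. The other hypotheses supply its
filters: each column of `[a b]` sums to -1, `a ≠ b`, and each column has at least two nonzero
entries, since otherwise it would extend to the negative of a clique column. -/

/-! ### The finite problem and the search. -/

/-- The determinant of the `2 × 2` matrix with columns `u` and `v`. -/
def det₂ (u v : ℤ × ℤ) : ℤ := u.1 * v.2 - u.2 * v.1

/-- The determinants of all pairs of disjoint subset sums are at most `3` in absolute value. -/
def SmallDets (s : Multiset (ℤ × ℤ)) : Prop :=
  ∀ U W : Multiset (ℤ × ℤ), U + W ≤ s → (det₂ U.sum W.sum).natAbs ≤ 3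

/-- `P` holds for `u + x` for all sums `x` of sublists. -/
def allSums (P : ℤ × ℤ → Bool) : ℤ × ℤ → List (ℤ × ℤ) → Bool
  | u, [] => P u
  | u, v :: l => allSums P u l && allSums P (u.1 + v.1, u.2 + v.2) l

/-- `P` holds for `(u + x, w + y)` for all sums `x` and `y` of disjoint sublists. -/
def allPairSums (P : ℤ × ℤ → ℤ × ℤ → Bool) : ℤ × ℤ → ℤ × ℤ → List (ℤ × ℤ) → Bool
  | u, w, [] => P u w
  | u, w, v :: l => allPairSums P u w l && allPairSums P (u.1 + v.1, u.2 + v.2) w l &&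
      allPairSums P u (w.1 + v.1, w.2 + v.2) l

/-- A cheap necessary condition for being able to add the row `c` to the rows `t`. -/
def canAdd (c : ℤ × ℤ) (t : List (ℤ × ℤ)) : Bool :=
  allSums (fun u => Nat.ble (det₂ u c).natAbs 3 &&
    (Nat.ble (u.1 + c.1).natAbs 3 && Nat.ble (u.1 + c.1 + 1).natAbs 3 &&
    (Nat.ble (u.2 + c.2).natAbs 3 && Nat.ble (u.2 + c.2 + 1).natAbs 3))) (0, 0) t

/-- The rows of the eight matrices. -/
def eightRowLists : List (List (ℤ × ℤ)) :=
  [[(-3, -2), (2, 1)], [(-2, 1), (1, -2)], [(-2, 1), (1, -1), (0, -1)],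
   [(-2, -1), (1, 1), (0, -1)], [(-2, -1), (2, 1), (-1, -1)], [(-1, -1), (-1, 1), (1, -1)],
   [(-1, -1), (1, 1), (-1, 0), (0, -1)], [(-1, 1), (1, -1), (-1, 0), (0, -1)]]

/-- The rows are those of one of the eight matrices up to a permutation of rows and columns. -/
def isListed (t : List (ℤ × ℤ)) : Bool :=
  eightRowLists.any fun m => t.isPerm m || (t.map Prod.swap).isPerm m

/-- The list either violates one of the hypotheses or is among the eight. -/
def isSettled (t : List (ℤ × ℤ)) : Bool :=
  !((t.map Prod.fst).sum == -1) || !((t.map Prod.snd).sum == -1) ||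
  t.all (fun p => p.1 == p.2) ||
  Nat.ble (t.countP fun p => !(p.1 == 0)) 1 || Nat.ble (t.countP fun p => !(p.2 == 0)) 1 ||
  isListed t ||
  !allPairSums (fun u w => Nat.ble (det₂ u w).natAbs 3) (0, 0) (0, 0) ((1, 0) :: (0, 1) :: t)

/-- All ways of adding elements of `cs` to `t` lead to settled lists. -/
def search : ℕ → List (ℤ × ℤ) → List (ℤ × ℤ) → Bool
  | 0, _, _ => false
  | _ + 1, [], t => isSettled t
  | k + 1, c :: cs, t => search k cs t && (!canAdd c t || search k (c :: cs) (c :: t))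

/-- The possible non-zero rows. -/
def candidateRows : List (ℤ × ℤ) :=
  [(-3, -3), (-3, -2), (-3, -1), (-3, 0), (-3, 1), (-3, 2),
   (-2, -3), (-2, -2), (-2, -1), (-2, 0), (-2, 1), (-2, 2),
   (-1, -3), (-1, -2), (-1, -1), (-1, 0), (-1, 1), (-1, 2),
   (0, -3), (0, -2), (0, -1), (0, 1), (0, 2),
   (1, -3), (1, -2), (1, -1), (1, 0), (1, 1), (1, 2),
   (2, -3), (2, -2), (2, -1), (2, 0), (2, 1), (2, 2)]

/-- Running out of fuel gives `false`, so `true` certifies completeness. Fuel 50 covers 35 discarded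
candidates, one leaf and up to 14 chosen rows. -/
theorem search_candidateRows : search 50 candidateRows [] = true := by
  decide +kernel

/-! ### Soundness of the search. -/

theorem allSums_eq_true {P : ℤ × ℤ → Bool} {l : List (ℤ × ℤ)} {u : ℤ × ℤ}
    (h : ∀ U : Multiset (ℤ × ℤ), U ≤ l → P (u + U.sum) = true) : allSums P u l = true := by
  induction l generalizing u with
  | nil => simpa [allSums] using h 0 (by simp)
  | cons v l ih =>
    rw [allSums, Bool.and_eq_true]
    refine ⟨ih fun U hU => h U ?_, ih fun U hU => ?_⟩
    · rw [← Multiset.cons_coe]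
      exact hU.trans (Multiset.le_cons_self _ _)
    · have := h (v ::ₘ U) (by rw [← Multiset.cons_coe]; exact Multiset.cons_le_cons _ hU)
      rwa [Multiset.sum_cons, ← add_assoc] at this

theorem allPairSums_eq_true {P : ℤ × ℤ → ℤ × ℤ → Bool} {l : List (ℤ × ℤ)} {u w : ℤ × ℤ}
    (h : ∀ U W : Multiset (ℤ × ℤ), U + W ≤ l → P (u + U.sum) (w + W.sum) = true) :
    allPairSums P u w l = true := by
  induction l generalizing u w with
  | nil => simpa [allPairSums] using h 0 0 (by simp)
  | cons v l ih =>
    rw [allPairSums, Bool.and_eq_true, Bool.and_eq_true]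
    refine ⟨⟨ih fun U W hU => h U W ?_, ih fun U W hU => ?_⟩, ih fun U W hU => ?_⟩
    · rw [← Multiset.cons_coe]
      exact hU.trans (Multiset.le_cons_self _ _)
    · have := h (v ::ₘ U) W (by
        rw [← Multiset.cons_coe, Multiset.cons_add]; exact Multiset.cons_le_cons _ hU)
      rwa [Multiset.sum_cons, ← add_assoc] at this
    · have := h U (v ::ₘ W) (by
        rw [← Multiset.cons_coe, Multiset.add_cons]; exact Multiset.cons_le_cons _ hU)
      rwa [Multiset.sum_cons, ← add_assoc] at this

theorem SmallDets.mono {s t : Multiset (ℤ × ℤ)} (ht : SmallDets t) (h : s ≤ t) : SmallDets s :=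
  fun U W hUW => ht U W (hUW.trans h)

/-- Pairing `U` with one unit row reads off a coordinate of its sum; moving the other unit row into
`U` shifts that coordinate by 1. -/
theorem SmallDets.bounds {s U : Multiset (ℤ × ℤ)}
    (hs : SmallDets ((1, 0) ::ₘ (0, 1) ::ₘ s)) (hU : U ≤ s) :
    (U.sum.1.natAbs ≤ 3 ∧ (U.sum.1 + 1).natAbs ≤ 3) ∧
      (U.sum.2.natAbs ≤ 3 ∧ (U.sum.2 + 1).natAbs ≤ 3) := by
  have h1 := hs U {(0, 1)} (by
    rw [add_comm, Multiset.singleton_add]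
    exact (Multiset.cons_le_cons _ hU).trans (Multiset.le_cons_self _ _))
  have h2 := hs ((1, 0) ::ₘ U) {(0, 1)} (by
    rw [add_comm, Multiset.singleton_add, Multiset.cons_swap]
    exact Multiset.cons_le_cons _ (Multiset.cons_le_cons _ hU))
  have h3 := hs U {(1, 0)} (by
    rw [add_comm, Multiset.singleton_add]
    exact Multiset.cons_le_cons _ (hU.trans (Multiset.le_cons_self _ _)))
  have h4 := hs ((0, 1) ::ₘ U) {(1, 0)} (by
    rw [add_comm, Multiset.singleton_add]
    exact Multiset.cons_le_cons _ (Multiset.cons_le_cons _ hU))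
  simp [det₂] at h1 h2 h3 h4
  omega

theorem SmallDets.canAdd {c : ℤ × ℤ} {t : List (ℤ × ℤ)}
    (hs : SmallDets ((1, 0) ::ₘ (0, 1) ::ₘ c ::ₘ (t : Multiset (ℤ × ℤ)))) :
    canAdd c t = true := by
  refine allSums_eq_true fun U hU => ?_
  have hc : c ::ₘ U ≤ c ::ₘ (t : Multiset (ℤ × ℤ)) := Multiset.cons_le_cons _ hU
  have hb := hs.bounds hc
  have hd := hs U {c} (by
    rw [add_comm, Multiset.singleton_add]
    exact hc.trans ((Multiset.le_cons_self _ _).trans (Multiset.le_cons_self _ _)))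
  have h0 : (0, 0) + U.sum = U.sum := zero_add _
  simp only [Multiset.sum_singleton] at hd
  simp only [Multiset.sum_cons, Prod.fst_add, Prod.snd_add] at hb
  simp only [h0, Bool.and_eq_true, Nat.ble_eq]
  rw [add_comm c.1, add_comm c.2] at hb
  exact ⟨hd, hb⟩

/-- The multiset `s` of rows still to be placed steers the search: if `c ∈ s`, one copy moves to `t`
and `c` stays available; otherwise `c` is discarded. -/
theorem exists_isSettled_of_search {k : ℕ} {cs t : List (ℤ × ℤ)} (h : search k cs t = true)
    (s : Multiset (ℤ × ℤ)) (hcs : ∀ x ∈ s, x ∈ cs)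
    (hs : SmallDets ((1, 0) ::ₘ (0, 1) ::ₘ (s + t))) :
    ∃ l : List (ℤ × ℤ), (l : Multiset (ℤ × ℤ)) = s + t ∧ isSettled l = true := by
  induction k generalizing cs t s with
  | zero => simp [search] at h
  | succ k ih =>
    cases cs with
    | nil =>
      obtain rfl : s = 0 := Multiset.eq_zero_of_forall_notMem fun x hx => by simpa using hcs x hx
      exact ⟨t, by simp, by simpa [search] using h⟩
    | cons c cs =>
      rw [search, Bool.and_eq_true, Bool.or_eq_true, Bool.not_eq_true'] at h
      by_cases hc : c ∈ s
      · obtain ⟨s, rfl⟩ := Multiset.exists_cons_of_mem hc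
        have e : c ::ₘ s + (t : Multiset (ℤ × ℤ)) = s + ((c :: t : List (ℤ × ℤ)) : Multiset _) := by
          rw [← Multiset.cons_coe, Multiset.cons_add, Multiset.add_cons]
        rw [e] at hs ⊢
        have hadd : canAdd c t = true := SmallDets.canAdd <| hs.mono <| Multiset.cons_le_cons _ <|
          Multiset.cons_le_cons _ <| by rw [Multiset.cons_coe]; exact Multiset.le_add_left _ _
        refine ih (h.2.resolve_left (by simp [hadd])) s (fun x hx => ?_) hs
        exact hcs x (Multiset.mem_cons_of_mem hx)
      · refine ih h.1 s (fun x hx => ?_) hs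
        rcases List.mem_cons.1 (hcs x hx) with rfl | hx'
        · exact absurd hx hc
        · exact hx'

theorem mem_candidateRows {x : ℤ × ℤ} (h0 : x ≠ 0)
    (h : (x.1.natAbs ≤ 3 ∧ (x.1 + 1).natAbs ≤ 3) ∧ (x.2.natAbs ≤ 3 ∧ (x.2 + 1).natAbs ≤ 3)) :
    x ∈ candidateRows := by
  obtain ⟨p, q⟩ := x
  simp only at h
  have hp : -3 ≤ p ∧ p ≤ 2 := by omega
  have hq : -3 ≤ q ∧ q ≤ 2 := by omega
  obtain ⟨hp1, hp2⟩ := hp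
  obtain ⟨hq1, hq2⟩ := hq
  clear h
  interval_cases p <;> interval_cases q <;> first | decide | exact absurd rfl h0

/-- Every alternative in `isSettled` other than `isListed` contradicts one of the hypotheses. -/
theorem SmallDets.exists_isListed {s : Multiset (ℤ × ℤ)}
    (hs : SmallDets ((1, 0) ::ₘ (0, 1) ::ₘ s)) (h0 : ∀ x ∈ s, x ≠ 0) (hsum : s.sum = (-1, -1))
    (hne : ∃ x ∈ s, x.1 ≠ x.2) (h1 : 1 < s.countP fun x => x.1 ≠ 0)
    (h2 : 1 < s.countP fun x => x.2 ≠ 0) :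
    ∃ l : List (ℤ × ℤ), (l : Multiset (ℤ × ℤ)) = s ∧ isListed l = true := by
  obtain ⟨l, hl, h⟩ := exists_isSettled_of_search search_candidateRows s
    (fun x hx => mem_candidateRows (h0 x hx) (by
      simpa using hs.bounds (Multiset.singleton_le.2 hx)))
    (by simpa using hs)
  rw [Multiset.coe_nil, add_zero] at hl
  subst hl
  refine ⟨l, rfl, ?_⟩
  have hp : allPairSums (fun u w => Nat.ble (det₂ u w).natAbs 3) (0, 0) (0, 0)
      ((1, 0) :: (0, 1) :: l) = true := by
    refine allPairSums_eq_true fun U W hUW => ?_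
    have := hs U W hUW
    rw [Nat.ble_eq]
    convert this using 3 <;> exact zero_add _
  have e1 : (l.map Prod.fst).sum = -1 := by
    have := congrArg Prod.fst hsum
    rw [Multiset.sum_coe] at this
    exact (map_list_sum (AddMonoidHom.fst ℤ ℤ) l).symm.trans this
  have e2 : (l.map Prod.snd).sum = -1 := by
    have := congrArg Prod.snd hsum
    rw [Multiset.sum_coe] at this
    exact (map_list_sum (AddMonoidHom.snd ℤ ℤ) l).symm.trans this
  rw [Multiset.coe_countP] at h1 h2
  have c1 : Nat.ble (l.countP fun p => !(p.1 == 0)) 1 = false := by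
    have e : (fun p : ℤ × ℤ => !(p.1 == 0)) = fun p => decide (p.1 ≠ 0) := by
      funext p; rw [decide_not]; rfl
    rw [e, Bool.eq_false_iff, ne_eq, Nat.ble_eq, not_le]
    exact h1
  have c2 : Nat.ble (l.countP fun p => !(p.2 == 0)) 1 = false := by
    have e : (fun p : ℤ × ℤ => !(p.2 == 0)) = fun p => decide (p.2 ≠ 0) := by
      funext p; rw [decide_not]; rfl
    rw [e, Bool.eq_false_iff, ne_eq, Nat.ble_eq, not_le]
    exact h2
  have c3 : l.all (fun p => p.1 == p.2) = false := by
    obtain ⟨x, hx, hx'⟩ := hne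
    rw [List.all_eq_false]
    exact ⟨x, hx, by simpa using hx'⟩
  simpa [isSettled, hp, e1, e2, c1, c2, c3] using h

/-! ### From modularity to determinants of row sums. -/

/-- The determinant of the identity matrix with columns `s` and `t` replaced. -/
theorem det_one_replace_two_columns {m : Type*} [Fintype m] [DecidableEq m] {s t : m}
    (hst : s ≠ t) (u v : m → ℤ) :
    (Matrix.of fun i j => if j = s then u i else if j = t then v i else (1 : Matrix m m ℤ) i j).det
      = u s * v t - u t * v s := by
  let U : Matrix m (Fin 2) ℤ := Matrix.of fun i => ![u i - (1 : Matrix m m ℤ) i s, v i - (1 : Matrix m m ℤ) i t]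
  let V : Matrix (Fin 2) m ℤ := Matrix.of ![Pi.single s 1, Pi.single t 1]
  -- A rank-two update of the identity, so `det (1 + U * V) = det (1 + V * U)` reduces to size 2.
  have h : (Matrix.of fun i j => if j = s then u i else if j = t then v i
      else (1 : Matrix m m ℤ) i j) = 1 + U * V := by
    ext i j
    by_cases h1 : j = s
    · subst h1
      simp [U, V, Matrix.mul_apply, Fin.sum_univ_two, Matrix.one_apply, hst]
    · by_cases h2 : j = t
      · subst h2
        simp [U, V, Matrix.mul_apply, Fin.sum_univ_two, Matrix.one_apply, h1]
      · simp [U, V, Matrix.mul_apply, Fin.sum_univ_two, Matrix.one_apply, h1, h2]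
  rw [h, Matrix.det_one_add_mul_comm, Matrix.det_fin_two]
  simp [U, V, Matrix.one_apply, hst, hst.symm, mul_comm]

/-- In the definition of a `Δ`-modular matrix the selections of rows and columns may be indexed by
any type of the right size and need not be injective. -/
theorem IsModular.natAbs_det_le {m n ι : Type*} [Fintype n] [Fintype ι] [DecidableEq ι] {Δ : ℕ}
    {A : Matrix m n ℤ} (hA : IsModular Δ A)
    (hι : (A.map (Int.cast : ℤ → ℝ)).rank = Fintype.card ι) (f : ι → m) (g : ι → n) :
    (A.submatrix f g).det.natAbs ≤ Δ := by
  by_cases hf : Function.Injective f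
  · by_cases hg : Function.Injective g
    · let e : Fin (A.map (Int.cast : ℤ → ℝ)).rank ≃ ι :=
        (finCongr hι).trans (Fintype.equivFin ι).symm
      have h := hA (e.toEmbedding.trans ⟨f, hf⟩) (e.toEmbedding.trans ⟨g, hg⟩)
      have e1 : A.submatrix (e.toEmbedding.trans ⟨f, hf⟩) (e.toEmbedding.trans ⟨g, hg⟩) =
          (A.submatrix f g).submatrix e e := rfl
      rw [e1, Matrix.det_submatrix_equiv_self, Int.abs_eq_natAbs] at h
      exact_mod_cast h
    · obtain ⟨i, j, hij, hne⟩ : ∃ i j, g i = g j ∧ i ≠ j := by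
        simpa [Function.Injective] using hg
      rw [Matrix.det_zero_of_column_eq hne (by simp [hij])]
      simp
  · obtain ⟨i, j, hij, hne⟩ : ∃ i j, f i = f j ∧ i ≠ j := by
      simpa [Function.Injective] using hf
    rw [Matrix.det_zero_of_row_eq hne (by ext; simp [hij])]
    simp

/-- The left kernel is spanned by the all-ones vector: clique columns force its members to be
constant, and the zero row sum puts the constants in it. -/
theorem rank_cliqueExtension {n : ℕ} {a b : Fin n → ℤ}
    (hsum : RowsSumToZero (cliqueExtension a b)) :
    ((cliqueExtension a b).map (Int.cast : ℤ → ℝ)).rank = n + 1 := by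
  set A := (cliqueExtension a b).map (Int.cast : ℤ → ℝ) with hA
  have hker : LinearMap.ker A.transpose.mulVecLin = Submodule.span ℝ {fun _ => (1 : ℝ)} := by
    ext w
    rw [LinearMap.mem_ker, Matrix.mulVecLin_apply, Submodule.mem_span_singleton]
    constructor
    · intro h
      have key : ∀ i j : Fin (n + 2), i < j → w i = w j := by
        intro i j hij
        have := congrFun h (Sum.inl ⟨(i, j), hij⟩)
        simp [hA, Matrix.mulVec, dotProduct, cliqueExtension, cliqueMatrix, Pi.single_apply,
          sub_mul, Finset.sum_sub_distrib] at this
        linarith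
      refine ⟨w 0, funext fun i => ?_⟩
      rcases (Fin.zero_le i).eq_or_lt with rfl | hi
      · simp
      · simp [key 0 i hi]
    · rintro ⟨c, rfl⟩
      ext j
      have := congrArg (Int.cast : ℤ → ℝ) (hsum j)
      simp only [Int.cast_sum, Int.cast_zero] at this
      simp [hA, Matrix.mulVec, dotProduct, ← Finset.sum_mul, this]
  have h := LinearMap.finrank_range_add_finrank_ker A.transpose.mulVecLin
  rw [hker, finrank_span_singleton (by intro h; simpa using congrFun h 0)] at h
  rw [← Matrix.rank_transpose, Matrix.rank]
  simp only [Module.finrank_fintype_fun_eq_card, Fintype.card_fin] at h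
  omega

theorem sum_mul_ite_val_eq {α : Type*} [DecidableEq α] {p : α → Prop} [Fintype {i // p i}]
    (F : {i // p i} → ℤ) (j : {i // p i}) :
    ∑ k, F k * (if k.1 = j.1 then 1 else 0) = F j := by
  rw [Finset.sum_eq_single j (fun k _ h => ?_) (by simp), if_pos rfl, mul_one]
  rw [if_neg fun h' => h (Subtype.ext h'), mul_zero]

/-- Contracting the rows in `S` and in `T`, with the remaining rows nonempty. -/
theorem natAbs_sum_mul_sum_sub_le {n : ℕ} {a b : Fin n → ℤ}
    (hmod : IsModular 3 (cliqueExtension a b)) (hsum : RowsSumToZero (cliqueExtension a b))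
    {S T : Finset (Fin (n + 2))} (hST : Disjoint S T) {s t r : Fin (n + 2)} (hs : s ∈ S)
    (ht : t ∈ T) (hrS : r ∉ S) (hrT : r ∉ T) :
    ((∑ i ∈ S, cliqueExtension a b i (Sum.inr 0)) * (∑ i ∈ T, cliqueExtension a b i (Sum.inr 1)) -
      (∑ i ∈ T, cliqueExtension a b i (Sum.inr 0)) *
        (∑ i ∈ S, cliqueExtension a b i (Sum.inr 1))).natAbs ≤ 3 := by
  set A := cliqueExtension a b with hA
  have hst : s ≠ t := fun h => Finset.disjoint_left.1 hST hs (h ▸ ht)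
  have hsr : s ≠ r := fun h => hrS (h ▸ hs)
  have htr : t ≠ r := fun h => hrT (h ▸ ht)
  let s' : {i : Fin (n + 2) // i ≠ r} := ⟨s, hsr⟩
  let t' : {i // i ≠ r} := ⟨t, htr⟩
  have hst' : s' ≠ t' := fun h => hst (congrArg Subtype.val h)
  have hcard : Fintype.card {i // i ≠ r} = n + 1 := by simp
  -- The edges from `j` to `root j` form three stars, centred at `s`, `t` and `r`.
  let root : {i // i ≠ r} → Fin (n + 2) := fun j => if j.1 ∈ S then s else if j.1 ∈ T then t else r
  have hroot : ∀ j : {i // i ≠ r}, j ≠ s' → j ≠ t' → j.1 ≠ root j := by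
    intro j h1 h2
    simp only [root]
    split_ifs
    · exact fun h => h1 (Subtype.ext h)
    · exact fun h => h2 (Subtype.ext h)
    · exact j.2
  -- the signed difference `e_j - e_(root j)` is a column of `A` up to sign
  have hcol : ∀ j : {i // i ≠ r}, ∃ (p : {p : Fin (n + 2) × Fin (n + 2) // p.1 < p.2} ⊕ Fin 2) (σ : ℤ),
      σ.natAbs = 1 ∧ (j = s' → p = Sum.inr 0 ∧ σ = 1) ∧ (j = t' → p = Sum.inr 1 ∧ σ = 1) ∧
      (j ≠ s' → j ≠ t' → ∀ i, A i p * σ =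
        (if i = j.1 then 1 else 0) - (if i = root j then 1 else 0)) := by
    intro j
    by_cases h1 : j = s'
    · exact ⟨Sum.inr 0, 1, rfl, fun _ => ⟨rfl, rfl⟩, fun h => absurd (h1.symm.trans h) hst',
        fun h => absurd h1 h⟩
    by_cases h2 : j = t'
    · exact ⟨Sum.inr 1, 1, rfl, fun h => absurd h h1, fun _ => ⟨rfl, rfl⟩,
        fun _ h => absurd h2 h⟩
    rcases lt_or_gt_of_ne (hroot j h1 h2) with h | h
    · refine ⟨Sum.inl ⟨(j.1, root j), h⟩, 1, rfl, fun h => absurd h h1, fun h => absurd h h2,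
        fun _ _ i => ?_⟩
      simp [hA, cliqueExtension, cliqueMatrix, Pi.single_apply]
    · refine ⟨Sum.inl ⟨(root j, j.1), h⟩, -1, rfl, fun h => absurd h h1, fun h => absurd h h2,
        fun _ _ i => ?_⟩
      simp [hA, cliqueExtension, cliqueMatrix, Pi.single_apply]
  choose g σ hσ hgs hgt hg using hcol
  -- Left multiplication by the transpose of `Q` replaces row `s` by the sum of the rows in `S`, and
  -- row `t` by the sum of those in `T`.
  let Q : Matrix {i // i ≠ r} {i // i ≠ r} ℤ := Matrix.of fun i j => if j = s' then (if i.1 ∈ S then 1 else 0)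
    else if j = t' then (if i.1 ∈ T then 1 else 0) else (1 : Matrix {i // i ≠ r} {i // i ≠ r} ℤ) i j
  have hQ : Q.det = 1 := by
    rw [det_one_replace_two_columns hst' (fun i : {i // i ≠ r} => if i.1 ∈ S then (1 : ℤ) else 0)
      (fun i : {i // i ≠ r} => if i.1 ∈ T then (1 : ℤ) else 0)]
    simp [s', t', hs, ht, Finset.disjoint_right.1 hST ht]
  let B : Matrix {i // i ≠ r} {i // i ≠ r} ℤ := A.submatrix Subtype.val g
  let u : Fin 2 → {i // i ≠ r} → ℤ := fun c i => ∑ k : {i // i ≠ r}, Q k i * A k.1 (Sum.inr c)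
  -- Both ends of an edge inside `S` or `T` cancel in the summed row, and row `r` is absent, so each
  -- edge column becomes a unit vector.
  have hprod : Q.transpose * B * Matrix.diagonal σ = Matrix.of fun i j =>
      if j = s' then u 0 i else if j = t' then u 1 i else (1 : Matrix {i // i ≠ r} {i // i ≠ r} ℤ) i j := by
    ext i j
    rw [Matrix.mul_diagonal, Matrix.mul_apply, Matrix.of_apply]
    by_cases h1 : j = s'
    · simp [h1, u, B, hgs s' rfl]
    by_cases h2 : j = t'
    · simp [h2, u, B, hgt t' rfl, hst'.symm]
    rw [if_neg h1, if_neg h2, Finset.sum_mul]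
    simp only [Matrix.transpose_apply, B, Matrix.submatrix_apply, mul_assoc, hg j h1 h2, mul_sub,
      Finset.sum_sub_distrib]
    rw [sum_mul_ite_val_eq]
    have hs1 : s ∉ T := Finset.disjoint_left.1 hST hs
    have ht1 : t ∉ S := Finset.disjoint_right.1 hST ht
    by_cases hjS : j.1 ∈ S
    · have hjT : j.1 ∉ T := Finset.disjoint_left.1 hST hjS
      have e : root j = s'.1 := if_pos hjS
      rw [e, sum_mul_ite_val_eq]
      by_cases hi : i = s'
      · subst hi
        simp [Q, show s'.1 ∈ S from hs, hjS, Matrix.one_apply, Ne.symm h1]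
      by_cases hi' : i = t'
      · subst hi'
        simp [Q, hst'.symm, s', hs1, hjT, Matrix.one_apply, Ne.symm h2]
      · simp [Q, hi, hi', Matrix.one_apply, Ne.symm hi, eq_comm]
    by_cases hjT : j.1 ∈ T
    · have e : root j = t'.1 := (if_neg hjS).trans (if_pos hjT)
      rw [e, sum_mul_ite_val_eq]
      by_cases hi : i = s'
      · subst hi
        simp [Q, t', ht1, hjS, Matrix.one_apply, Ne.symm h1]
      by_cases hi' : i = t'
      · simp [Q, hi', hst'.symm, t', ht, hjT, Matrix.one_apply, Ne.symm h2]
      · simp [Q, hi, hi', Matrix.one_apply, Ne.symm hi', eq_comm]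
    · have e : root j = r := (if_neg hjS).trans (if_neg hjT)
      rw [e, Finset.sum_eq_zero fun k _ => by rw [if_neg k.2, mul_zero], sub_zero]
      by_cases hi : i = s'
      · subst hi
        simp [Q, hjS, Matrix.one_apply, Ne.symm h1]
      by_cases hi' : i = t'
      · subst hi'
        simp [Q, hst'.symm, hjT, Matrix.one_apply, Ne.symm h2]
      · simp [Q, hi, hi', Matrix.one_apply, eq_comm]
  have hsub : ∀ (X : Finset (Fin (n + 2))), r ∉ X → ∀ c, ∑ k : {i // i ≠ r},
      (if k.1 ∈ X then (1 : ℤ) else 0) * A k.1 (Sum.inr c) = ∑ i ∈ X, A i (Sum.inr c) := by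
    intro X hX c
    have h := Finset.sum_subtype (F := inferInstance) (p := fun i => i ≠ r) (Finset.univ.erase r) (by simp)
      (fun i => (if i ∈ X then (1 : ℤ) else 0) * A i (Sum.inr c))
    rw [← h]
    simp only [ite_mul, one_mul, zero_mul]
    rw [← Finset.sum_filter]
    refine Finset.sum_congr ?_ fun _ _ => rfl
    ext i
    simp only [Finset.mem_filter, Finset.mem_erase, Finset.mem_univ, and_true]
    exact ⟨fun h => h.2, fun h => ⟨fun h' => hX (h' ▸ h), h⟩⟩
  have hus : ∀ c, u c s' = ∑ i ∈ S, A i (Sum.inr c) := fun c => by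
    rw [← hsub S hrS]; simp [u, Q]
  have hut : ∀ c, u c t' = ∑ i ∈ T, A i (Sum.inr c) := fun c => by
    rw [← hsub T hrT]; simp [u, Q, hst'.symm]
  have hdet := congrArg Matrix.det hprod
  rw [det_one_replace_two_columns hst', Matrix.det_mul, Matrix.det_mul, Matrix.det_transpose, hQ,
    one_mul, Matrix.det_diagonal, hus, hus, hut, hut] at hdet
  rw [← hdet, Int.natAbs_mul, ← Int.natAbsHom_apply (∏ i, σ i), map_prod]
  simp only [Int.natAbsHom_apply, hσ, Finset.prod_const_one, mul_one]
  exact hmod.natAbs_det_le ((rank_cliqueExtension hsum).trans hcard.symm) _ _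

theorem natAbs_det₂_sum_le {n : ℕ} {a b : Fin n → ℤ}
    (hmod : IsModular 3 (cliqueExtension a b)) (hsum : RowsSumToZero (cliqueExtension a b))
    {S T : Finset (Fin (n + 2))} (hST : Disjoint S T) :
    (det₂ (∑ i ∈ S, (cliqueExtension a b i (Sum.inr 0), cliqueExtension a b i (Sum.inr 1)))
      (∑ i ∈ T, (cliqueExtension a b i (Sum.inr 0), cliqueExtension a b i (Sum.inr 1)))).natAbs
        ≤ 3 := by
  simp only [det₂, Prod.fst_sum, Prod.snd_sum]
  rcases S.eq_empty_or_nonempty with rfl | ⟨s, hs⟩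
  · simp
  rcases T.eq_empty_or_nonempty with rfl | ⟨t, ht⟩
  · simp
  by_cases hr : ∃ r, r ∉ S ∪ T
  · obtain ⟨r, hr⟩ := hr
    rw [Finset.mem_union, not_or] at hr
    have := natAbs_sum_mul_sum_sub_le hmod hsum hST hs ht hr.1 hr.2
    rwa [mul_comm (∑ i ∈ T, cliqueExtension a b i (Sum.inr 0))] at this
  -- With no row left to delete, the two sums are opposite and the determinant vanishes.
  · have hu : S ∪ T = Finset.univ := Finset.eq_univ_iff_forall.2 (by simpa [or_iff_not_imp_left] using hr)
    have h : ∀ c, ∑ i ∈ T, cliqueExtension a b i (Sum.inr c) =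
        -∑ i ∈ S, cliqueExtension a b i (Sum.inr c) := fun c => by
      have := hsum (Sum.inr c)
      rw [← hu, Finset.sum_union hST] at this
      linarith
    rw [h, h]
    ring_nf
    simp

/-! ### Passing between indexed rows and multisets. -/

theorem Multiset.exists_le_map_eq {α β : Type*} {f : α → β} {s : Multiset α} {u : Multiset β}
    (h : u ≤ s.map f) : ∃ t ≤ s, t.map f = u := by
  classical
  induction s using Multiset.induction generalizing u with
  | empty => exact ⟨0, le_rfl, by simpa [eq_comm] using h⟩
  | cons a s ih =>
    rw [Multiset.map_cons] at h
    by_cases ha : f a ∈ u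
    · obtain ⟨v, rfl⟩ := Multiset.exists_cons_of_mem ha
      obtain ⟨t, ht, rfl⟩ := ih ((Multiset.cons_le_cons_iff _).1 h)
      exact ⟨a ::ₘ t, Multiset.cons_le_cons _ ht, by simp⟩
    · obtain ⟨t, ht, rfl⟩ := ih ((Multiset.le_cons_of_notMem ha).1 h)
      exact ⟨t, ht.trans (Multiset.le_cons_self _ _), rfl⟩

theorem smallDets_map_univ {ι : Type*} [Fintype ι] {f : ι → ℤ × ℤ}
    (h : ∀ S T : Finset ι, Disjoint S T → (det₂ (∑ i ∈ S, f i) (∑ i ∈ T, f i)).natAbs ≤ 3) :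
    SmallDets (Finset.univ.val.map f) := by
  classical
  intro U W hUW
  obtain ⟨t, ht, e⟩ := Multiset.exists_le_map_eq hUW
  obtain ⟨S, hS, rfl⟩ := Multiset.exists_le_map_eq (e ▸ Multiset.le_add_right U W)
  obtain ⟨T, rfl⟩ := Multiset.le_iff_exists_add.1 hS
  rw [Multiset.map_add, add_right_inj] at e
  subst e
  have hn := Multiset.nodup_of_le ht Finset.univ.nodup
  rw [Multiset.nodup_add] at hn
  exact h ⟨S, hn.1⟩ ⟨T, hn.2.1⟩ (Finset.disjoint_val.1 hn.2.2)

/-- Equal multiplicities mean equinumerous fibres, whose bijections glue together. -/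
theorem exists_equiv_of_map_univ_eq {α β γ : Type*} [Fintype α] [Fintype β] [DecidableEq γ]
    {f : α → γ} {g : β → γ}
    (h : Finset.univ.val.map f = Finset.univ.val.map g) : ∃ e : α ≃ β, ∀ i, f i = g (e i) := by
  have hc : ∀ c, Fintype.card {i // f i = c} = Fintype.card {j // g j = c} := fun c => by
    have := congrArg (Multiset.count c) h
    rw [Multiset.count_map, Multiset.count_map] at this
    rw [Fintype.card_subtype, Fintype.card_subtype, Finset.card, Finset.card, Finset.filter_val,
      Finset.filter_val]
    simpa only [eq_comm] using this
  refine ⟨Equiv.ofFiberEquiv (f := f) (g := g) fun c => Fintype.equivOfCardEq (hc c), fun i => ?_⟩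
  exact (Equiv.ofFiberEquiv_map _ i).symm

theorem reducesTo_of_rows_eq {m k : ℕ} {a b : Fin m → ℤ} {M : Matrix (Fin k) (Fin 2) ℤ}
    (σ : Equiv.Perm (Fin 2))
    (h : (Finset.univ.val.map fun i => (a i, b i)).filter (· ≠ 0) =
      Finset.univ.val.map fun i => (M i (σ 0), M i (σ 1))) :
    ReducesTo (twoColumns a b) M := by
  classical
  have hp : ∀ i, (∃ j, twoColumns a b i j ≠ 0) ↔ (a i, b i) ≠ 0 := fun i => by
    simp [twoColumns, Fin.exists_fin_two, Prod.ext_iff, imp_iff_not_or]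
  have h' : (Finset.univ.val.map fun i : {i // ∃ j, twoColumns a b i j ≠ 0} => (a i.1, b i.1)) =
      Finset.univ.val.map fun i => (M i (σ 0), M i (σ 1)) := by
    rw [← h, Multiset.filter_map]
    have e : (Finset.univ.val.map fun i : {i // ∃ j, twoColumns a b i j ≠ 0} => i.1) =
        Finset.univ.val.filter ((· ≠ 0) ∘ fun i => (a i, b i)) := by
      rw [Finset.univ_val_map_subtype_val, Finset.filter_val]
      exact Multiset.filter_congr fun i _ => hp i
    rw [← e, Multiset.map_map]
    rfl
  obtain ⟨e, he⟩ := exists_equiv_of_map_univ_eq h'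
  refine ⟨e, σ, fun i j => ?_⟩
  have := he i
  rw [Prod.ext_iff] at this
  fin_cases j
  · exact this.1
  · exact this.2

/-! ### Column sums, parallel columns and the conclusion. -/

theorem sum_append_eq {n : ℕ} {a : Fin n → ℤ} {p q : ℤ} (h : ∑ i, Fin.append a ![p, q] i = 0) :
    ∑ i, a i = -(p + q) := by
  simp [Fin.sum_univ_add, Fin.sum_univ_two] at h
  linarith

/-- A column of a matrix without parallel columns that has coordinate sum zero, and a single `1`
among its last two coordinates, has at least two further nonzero entries. -/
theorem one_lt_card_support {n : ℕ} {a : Fin n → ℤ} (c : Fin 2)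
    (hsum : ∑ i, Fin.append a (Pi.single c 1) i = 0)
    (hpar : ∀ p : {p : Fin (n + 2) × Fin (n + 2) // p.1 < p.2},
      ¬ AreParallel (Fin.append a (Pi.single c 1)) fun i => cliqueMatrix (n + 2) i p) :
    1 < (Finset.univ.filter fun i => a i ≠ 0).card := by
  by_contra! hcard
  rw [Finset.card_le_one] at hcard
  have hs : ∑ i, a i = -1 := by
    simp [Fin.sum_univ_add] at hsum
    linarith
  obtain ⟨k, -, hk⟩ := Finset.exists_ne_zero_of_sum_ne_zero (s := Finset.univ) (f := a)
    (by rw [hs]; decide)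
  have h0 : ∀ i, i ≠ k → a i = 0 := fun i hi => by
    by_contra h
    exact hi (hcard i (by simpa using h) k (by simpa using hk))
  rw [Finset.sum_eq_single k (fun i _ => h0 i) (by simp)] at hs
  -- The only nonzero entry of `a` is -1, at `k`. As `k` precedes the last two rows, the clique
  -- column has its `1` at `k`, whence the factor -1.
  refine hpar ⟨(Fin.castAdd 2 k, Fin.natAdd n c), by
    simp only [Fin.lt_def, Fin.val_castAdd, Fin.val_natAdd]; omega⟩
    ⟨-1, by norm_num, fun i => ?_⟩
  refine Fin.addCases (fun i => ?_) (fun i => ?_) i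
  · by_cases hi : i = k
    · subst hi
      simp [cliqueMatrix, hs, Pi.single_apply, Fin.ext_iff,
        (i.2.trans_le (Nat.le_add_right _ _)).ne]
    · have : (i : ℕ) ≠ n + c := by omega
      have h' : (i : ℕ) ≠ k := fun h => hi (Fin.ext h)
      simp [cliqueMatrix, h0 i hi, Pi.single_apply, Fin.ext_iff, this, h']
  · have : n + (i : ℕ) ≠ k := by omega
    by_cases hi : i = c
    · simp [cliqueMatrix, hi, Pi.single_apply, Fin.ext_iff, hi ▸ this]
    · simp [cliqueMatrix, hi, Pi.single_apply, Fin.ext_iff, this, Fin.val_ne_of_ne hi]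

/-- The rows of a matrix with two columns, the columns being rearranged by `σ`. -/
def rowList {k : ℕ} (M : Matrix (Fin k) (Fin 2) ℤ) (σ : Equiv.Perm (Fin 2)) : List (ℤ × ℤ) :=
  List.ofFn fun i => (M i (σ 0), M i (σ 1))

theorem exists_mem_eightMatrices_of_isListed {l : List (ℤ × ℤ)} (h : isListed l = true) :
    ∃ M ∈ eightMatrices, ∃ σ : Equiv.Perm (Fin 2), l.Perm (rowList M.2 σ) := by
  have hrows : eightRowLists = eightMatrices.map fun M => rowList M.2 1 := by decide
  simp only [isListed, List.any_eq_true, Bool.or_eq_true, List.isPerm_iff, hrows,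
    List.mem_map] at h
  obtain ⟨_, ⟨M, hM, rfl⟩, h | h⟩ := h
  · exact ⟨M, hM, 1, h⟩
  · refine ⟨M, hM, Equiv.swap 0 1, ?_⟩
    have := h.map Prod.swap
    rw [List.map_map, Prod.swap_swap_eq, List.map_id] at this
    convert this using 1
    simp [rowList, List.map_ofFn, Function.comp_def]

theorem mainTheorem7 (n : ℕ) (a b : Fin n → ℤ) (hab : a ≠ b)
    (hmod : IsModular 3 (cliqueExtension a b))
    (hsum : RowsSumToZero (cliqueExtension a b))
    (hpar : NoParallelColumns (cliqueExtension a b)) :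
    ∃ M ∈ eightMatrices, ReducesTo (twoColumns a b) M.2 := by
  have hrow : (Finset.univ.val.map fun i : Fin (n + 2) =>
      (cliqueExtension a b i (Sum.inr 0), cliqueExtension a b i (Sum.inr 1))) =
      (1, 0) ::ₘ (0, 1) ::ₘ (Finset.univ.val.map fun i => (a i, b i)) := by
    rw [Fin.univ_val_map, Fin.univ_val_map, List.ofFn_add]
    simp [cliqueExtension, twoColumns, ← Multiset.coe_add]
    rw [add_comm]
    rfl
  have hsmall := smallDets_map_univ fun S T hST => natAbs_det₂_sum_le hmod hsum hST
  rw [hrow] at hsmall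
  set s : Multiset (ℤ × ℤ) := Finset.univ.val.map fun i => (a i, b i) with hs
  have e0 : (![1, 0] : Fin 2 → ℤ) = Pi.single 0 1 := by decide
  have e1 : (![0, 1] : Fin 2 → ℤ) = Pi.single 1 1 := by decide
  have ha : ∑ i, a i = -1 := sum_append_eq (hsum (Sum.inr 0))
  have hb : ∑ i, b i = -1 := sum_append_eq (hsum (Sum.inr 1))
  have hca := one_lt_card_support (a := a) 0 (e0 ▸ hsum (Sum.inr 0)) fun p =>
    e0 ▸ hpar (Sum.inr 0) (Sum.inl p) (by simp)
  have hcb := one_lt_card_support (a := b) 1 (e1 ▸ hsum (Sum.inr 1)) fun p =>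
    e1 ▸ hpar (Sum.inr 1) (Sum.inl p) (by simp)
  rw [Finset.card, Finset.filter_val] at hca hcb
  have hssum : s.sum = (-1, -1) := by
    exact Prod.ext ((Prod.fst_sum ..).trans ha) ((Prod.snd_sum ..).trans hb)
  obtain ⟨l, hl, hlist⟩ := SmallDets.exists_isListed (s := s.filter (· ≠ 0))
    (hsmall.mono <| Multiset.cons_le_cons _ <| Multiset.cons_le_cons _ <| Multiset.filter_le _ _)
    (fun x hx => (Multiset.mem_filter.1 hx).2)
    (by
      rw [← hssum, ← Multiset.filter_add_not (· ≠ 0) s, Multiset.sum_add]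
      rw [Multiset.sum_eq_zero (s := s.filter fun x => ¬ x ≠ 0) fun x hx => by
        simpa using (Multiset.mem_filter.1 hx).2, add_zero]
      simp)
    (by
      obtain ⟨i, hi⟩ := Function.ne_iff.1 hab
      refine ⟨(a i, b i), Multiset.mem_filter.2 ⟨?_, ?_⟩, hi⟩
      · exact Multiset.mem_map_of_mem _ (Finset.mem_univ i)
      · intro h
        rw [Prod.ext_iff] at h
        exact hi (h.1.trans h.2.symm))
    (by
      rw [Multiset.countP_filter, hs, Multiset.countP_map]
      refine hca.trans_eq (congrArg Multiset.card (Multiset.filter_congr fun i _ => ?_))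
      simp +contextual [Prod.ext_iff])
    (by
      rw [Multiset.countP_filter, hs, Multiset.countP_map]
      refine hcb.trans_eq (congrArg Multiset.card (Multiset.filter_congr fun i _ => ?_))
      simp +contextual [Prod.ext_iff])
  obtain ⟨M, hM, σ, hσ⟩ := exists_mem_eightMatrices_of_isListed hlist
  refine ⟨M, hM, reducesTo_of_rows_eq σ ?_⟩
  rw [← hs, ← hl, Fin.univ_val_map]
  exact Multiset.coe_eq_coe.2 hσ
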